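/- Let $q\in\mathbb{C}$ with $|q|<1$, and write $(a;q)_n=\prod_{i=0}^{n-1}(1-aq^i)$, $(q)_n=(q;q)_n$, $(a;q)_\infty=\prod_{i\ge 0}(1-aq^i)$ and $(a,b,c;q)_\infty=(a;q)_\infty(b;q)_\infty(c;q)_\infty$. Let $k,j,r$ be integers with $0\le j,r\le k$ and $j+r\le k$. Then the sum on the left below, over all integer sequences $s_1\ge s_2\ge\cdots\ge s_k\ge 0$, converges absolutely, and $$ \sum_{s_1\ge s_2\ge\cdots\ge s_k\ge 0} \frac{q^{s_1^2+\cdots+s_k^2-(s_1+\cdots+s_j)+(s_{k-r+1}+\cdots+s_k)}} {(q)_{s_1-s_2}\cdots(q)_{s_{k-1}-s_k}(q)_{s_k}} =\sum_{s=0}^{j} \frac{(q^{k+1-r+j-2s},\,q^{k+2+r-j+2s},\,q^{2k+3};\,q^{2k+3})_\infty}{(q;q)_\infty}. $$ (For $k=0$ the left side is the single term $1$; $0^0=1$ when $q=0$.) -/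

import Mathlib

noncomputable section

/-- The finite `q`-shifted factorial `(a; q)_n = ∏_{i=0}^{n-1} (1 - a q^i)`. -/
def qPoch (a q : ℂ) (n : ℕ) : ℂ :=
  ∏ i ∈ Finset.range n, (1 - a * q ^ i)

/-- The infinite `q`-shifted factorial `(a; q)_∞ = ∏_{i ≥ 0} (1 - a q^i)`. -/
def qPochInf (a q : ℂ) : ℂ :=
  ∏' i : ℕ, (1 - a * q ^ i)

/-- The product defining `(a; q)_∞` converges for `|q| < 1`. -/
theorem multipliable_qPochInf (a : ℂ) {q : ℂ} (hq : ‖q‖ < 1) :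
    Multipliable fun i : ℕ => (1 - a * q ^ i) := by
  have h : Summable fun i : ℕ => ‖-(a * q ^ i)‖ := by
    simp only [norm_neg, norm_mul, norm_pow]
    exact (summable_geometric_of_lt_one (norm_nonneg q) hq).mul_left _
  simpa [sub_eq_add_neg] using multipliable_one_add_of_summable h

/-- The entry `s_{i+1}` of `(s_1, …, s_k)`, with `s_{k+1} = 0`. Indices are shifted by one:
the Lean entry `s i` (`0 ≤ i < k`) is the mathematical `s_{i+1}`. -/
def entry {k : ℕ} (s : Fin k → ℕ) (i : ℕ) : ℕ :=
  if h : i < k then s ⟨i, h⟩ else 0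

/-- The exponent
`s_1^2 + ⋯ + s_k^2 - (s_1 + ⋯ + s_j) + (s_{k-r+1} + ⋯ + s_k)`. -/
def multisumExponent (k j r : ℕ) (s : Fin k → ℕ) : ℤ :=
  (∑ i ∈ Finset.range k, (entry s i : ℤ) ^ 2)
    - (∑ i ∈ Finset.range j, (entry s i : ℤ))
    + ∑ i ∈ Finset.Ico (k - r) k, (entry s i : ℤ)

/-- The denominator `(q)_{s_1-s_2} ⋯ (q)_{s_{k-1}-s_k} (q)_{s_k}`, where `(q)_n = (q; q)_n`. -/
def multisumDenominator (k : ℕ) (q : ℂ) (s : Fin k → ℕ) : ℂ :=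
  ∏ i ∈ Finset.range k, qPoch q q (entry s i - entry s (i + 1))

/-- The summand on the product side:
`(q^{k+1-r+j-2s}, q^{k+2+r-j+2s}, q^{2k+3}; q^{2k+3})_∞ / (q; q)_∞`. -/
def productTerm (k j r s : ℕ) (q : ℂ) : ℂ :=
  qPochInf (q ^ ((k : ℤ) + 1 - r + j - 2 * s)) (q ^ (2 * k + 3))
    * qPochInf (q ^ ((k : ℤ) + 2 + r - j + 2 * s)) (q ^ (2 * k + 3))
    * qPochInf (q ^ (2 * k + 3)) (q ^ (2 * k + 3))
    / qPochInf q q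

end

/-! The proof runs a Bailey chain on sums with a finite outer bound `N` and then lets `N` tend to
infinity. By the limiting `q`-Chu–Vandermonde sum, summation against `q^(s²+bs) / (q)_{N-s}`
multiplies the kernel `1 / ((q)_{N-n} (q)_{N+n+b})` by `q^(n²+bn)` (`sum_pow_mul_baileyKernel`).

The nested sum is evaluated from the innermost entry outwards, starting from the unit Bailey pair
relative to `q`. The last `r` entries are steps relative to `q`; `one_sub_pow_mul_baileyKernel` then
passes to `a = 1`, where the middle `m = k - j - r` entries are again diagonal steps. The first `j`
entries carry `q^(s²-s)`, and their step multiplies the kernel by `q^(n²+n) + q^(n²-n) - q^(n²+N)`.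
This depends on `N`, but the iterates keep the shape `U_j - q^(n²+N) U_{j-1}` with a Chebyshev
recurrence for `U` (`nestedSum_eq`).

In the limit one side is the multisum divided by `(q)_∞`, the other a series in `n` times
`(q)_∞^(-2)`. Since `U_j` has `j + 1` monomials, that series is a sum of `j + 1` two-sided theta
series in base `q^(2k+3)`, and the Jacobi triple product (`hasSum_thetaTerm`) evaluates each. -/

/-! ### Reciprocal `q`-factorials -/

/-- The reciprocal `1 / (q; q)_n`, extended by `0` to negative `n`. -/
noncomputable def invPoch (q : ℂ) (n : ℤ) : ℂ :=
  if 0 ≤ n then (qPoch q q n.toNat)⁻¹ else 0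

theorem invPoch_natCast (q : ℂ) (n : ℕ) : invPoch q n = (qPoch q q n)⁻¹ := by
  simp [invPoch]

theorem invPoch_of_neg (q : ℂ) {n : ℤ} (hn : n < 0) : invPoch q n = 0 := by
  simp [invPoch, not_le.mpr hn]

@[simp] theorem invPoch_zero (q : ℂ) : invPoch q 0 = 1 := by
  simp [invPoch, qPoch]

theorem one_sub_pow_ne_zero {q : ℂ} (hq : ‖q‖ < 1) {n : ℕ} (hn : n ≠ 0) : 1 - q ^ n ≠ 0 := by
  intro h
  have h1 : ‖q ^ n‖ < 1 := by
    rw [norm_pow]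
    exact pow_lt_one₀ (norm_nonneg q) hq hn
  rw [← sub_eq_zero.mp h] at h1
  simp at h1

theorem qPoch_succ (a q : ℂ) (n : ℕ) : qPoch a q (n + 1) = qPoch a q n * (1 - a * q ^ n) :=
  Finset.prod_range_succ _ _

theorem qPoch_ne_zero {q : ℂ} (hq : ‖q‖ < 1) (n : ℕ) : qPoch q q n ≠ 0 := by
  refine Finset.prod_ne_zero_iff.mpr fun i _ => ?_
  rw [← pow_succ']
  exact one_sub_pow_ne_zero hq i.succ_ne_zero

/-- The recurrence `1 / (q)_{n-1} = (1 - q^n) / (q)_n`. -/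
theorem invPoch_sub_one {q : ℂ} (hq : ‖q‖ < 1) (n : ℕ) :
    invPoch q ((n : ℤ) - 1) = (1 - q ^ n) * invPoch q n := by
  cases n with
  | zero => simp [invPoch]
  | succ n =>
    have h : (((n + 1 : ℕ) : ℤ) - 1) = (n : ℕ) := by push_cast; ring
    have h1 := qPoch_ne_zero hq n
    have h2 := one_sub_pow_ne_zero hq n.succ_ne_zero
    rw [h, invPoch_natCast, invPoch_natCast, qPoch_succ, ← pow_succ', mul_inv]
    field_simp

/-! ### Finite `q`-Chu–Vandermonde sums -/

/-- The limiting form of the `q`-Chu–Vandermonde sum. -/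
theorem sum_sq_mul_invPoch {q : ℂ} (hq : ‖q‖ < 1) (L a : ℕ) :
    ∑ t ∈ Finset.range (L + 1),
        q ^ (t ^ 2 + a * t) * invPoch q (L - t) * invPoch q t * invPoch q (t + a)
      = invPoch q L * invPoch q (L + a) := by
  induction L generalizing a with
  | zero => simp
  | succ L ih =>
    have h0 : 1 - q ^ (L + 1) ≠ 0 := one_sub_pow_ne_zero hq L.succ_ne_zero
    -- Split `1 - q^(L+1) = (1 - q^(L+1-t)) + q^(L+1-t) (1 - q^t)`. The first part is the sum for
    -- `(L, a)`; the second, after `t = u + 1`, is the one for `(L, a + 1)`.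
    have key : ∀ t ∈ Finset.range (L + 1 + 1),
        (1 - q ^ (L + 1)) * (q ^ (t ^ 2 + a * t) * invPoch q ((L + 1 : ℕ) - t) * invPoch q t
            * invPoch q (t + a))
          = q ^ (t ^ 2 + a * t) * invPoch q (L - t) * invPoch q t * invPoch q (t + a)
            + q ^ (t ^ 2 + a * t + (L + 1 - t)) * invPoch q ((L + 1 : ℕ) - t)
              * invPoch q (t - 1) * invPoch q (t + a) := by
      intro t ht
      have ht' : t ≤ L + 1 := by simpa [Nat.lt_succ_iff] using ht
      have e1 := invPoch_sub_one hq (L + 1 - t)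
      have e2 := invPoch_sub_one hq t
      have e3 : ((L + 1 - t : ℕ) : ℤ) - 1 = L - t := by omega
      have e4 : ((L + 1 - t : ℕ) : ℤ) = (L + 1 : ℕ) - t := by omega
      have e5 : q ^ (L + 1) = q ^ (L + 1 - t) * q ^ t := by rw [← pow_add]; congr 1; omega
      rw [e3, e4] at e1
      rw [e1, e2, e5, pow_add q (t ^ 2 + a * t)]
      ring
    apply mul_left_cancel₀ h0
    rw [Finset.mul_sum, Finset.sum_congr rfl key, Finset.sum_add_distrib, Finset.sum_range_succ,
      ih a, invPoch_of_neg q (n := (L : ℤ) - (L + 1 : ℕ)) (by push_cast; omega),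
      Finset.sum_range_succ' _ (L + 1), invPoch_of_neg q (n := ((0 : ℕ) : ℤ) - 1) (by simp)]
    have key2 : ∀ u ∈ Finset.range (L + 1),
        q ^ ((u + 1) ^ 2 + a * (u + 1) + (L + 1 - (u + 1))) * invPoch q ((L + 1 : ℕ) - (u + 1 : ℕ))
              * invPoch q ((u + 1 : ℕ) - 1) * invPoch q ((u + 1 : ℕ) + a)
          = q ^ (L + 1 + a) * (q ^ (u ^ 2 + (a + 1) * u) * invPoch q (L - u) * invPoch q u
            * invPoch q (u + (a + 1 : ℕ))) := by
      intro u hu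
      have hu' : u ≤ L := by simpa [Nat.lt_succ_iff] using hu
      have e : (u + 1) ^ 2 + a * (u + 1) + (L + 1 - (u + 1)) = L + 1 + a + (u ^ 2 + (a + 1) * u) := by
        obtain ⟨d, rfl⟩ := Nat.exists_eq_add_of_le hu'
        have : u + d + 1 - (u + 1) = d := by omega
        rw [this]; ring
      rw [e, pow_add]
      push_cast
      ring_nf
    rw [Finset.sum_congr rfl key2, ← Finset.mul_sum, ih (a + 1)]
    have e1 := invPoch_sub_one hq (L + 1)
    have e2 := invPoch_sub_one hq (L + 1 + a)
    have e3 : ((L + 1 + a : ℕ) : ℤ) - 1 = L + a := by push_cast; ring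
    have e4 : ((L + 1 : ℕ) : ℤ) - 1 = L := by push_cast; ring
    have e5 : ((L + 1 : ℕ) : ℤ) + a = (L + 1 + a : ℕ) := by push_cast; ring
    have e6 : (L : ℤ) + (a + 1 : ℕ) = (L + 1 + a : ℕ) := by push_cast; ring
    rw [e3] at e2
    rw [e4] at e1
    rw [e5, e6, e1, e2]
    ring

/-- The variant of `sum_sq_mul_invPoch` with an additional weight `q ^ (-t)`. -/
theorem sum_sq_sub_mul_invPoch {q : ℂ} (hq : ‖q‖ < 1) (L a : ℕ) :
    ∑ t ∈ Finset.range (L + 1),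
        q ^ (t ^ 2 + a * t - t) * invPoch q (L - t) * invPoch q t * invPoch q (t + a)
      = (1 + q ^ a - q ^ (L + a)) * (invPoch q L * invPoch q (L + a)) := by
  have hle (t : ℕ) : t ≤ t ^ 2 + a * t := by nlinarith [Nat.le_self_pow (n := 2) (by simp) t]
  -- Split `1 = q^t + (1 - q^t)`; each part reduces to the unweighted sum.
  have key : ∀ t ∈ Finset.range (L + 1),
      q ^ (t ^ 2 + a * t - t) * invPoch q (L - t) * invPoch q t * invPoch q (t + a)
        = q ^ (t ^ 2 + a * t) * invPoch q (L - t) * invPoch q t * invPoch q (t + a)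
          + q ^ (t ^ 2 + a * t - t) * invPoch q (L - t) * invPoch q (t - 1)
            * invPoch q (t + a) := by
    intro t _
    have e : q ^ (t ^ 2 + a * t) = q ^ (t ^ 2 + a * t - t) * q ^ t := by
      rw [← pow_add, Nat.sub_add_cancel (hle t)]
    rw [invPoch_sub_one hq t, e]
    ring
  rw [Finset.sum_congr rfl key, Finset.sum_add_distrib, sum_sq_mul_invPoch hq L a,
    Finset.sum_range_succ', invPoch_of_neg q (n := ((0 : ℕ) : ℤ) - 1) (by simp)]
  cases L with
  | zero => simp
  | succ L =>
    have key2 : ∀ u ∈ Finset.range (L + 1),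
        q ^ ((u + 1) ^ 2 + a * (u + 1) - (u + 1)) * invPoch q ((L + 1 : ℕ) - (u + 1 : ℕ))
            * invPoch q ((u + 1 : ℕ) - 1) * invPoch q ((u + 1 : ℕ) + a)
          = q ^ a * (q ^ (u ^ 2 + (a + 1) * u) * invPoch q (L - u) * invPoch q u
            * invPoch q (u + (a + 1 : ℕ))) := by
      intro u _
      have e : (u + 1) ^ 2 + a * (u + 1) - (u + 1) = a + (u ^ 2 + (a + 1) * u) := by
        rw [Nat.sub_eq_iff_eq_add (hle _)]; ring
      rw [e, pow_add]
      push_cast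
      ring_nf
    rw [Finset.sum_congr rfl key2, ← Finset.mul_sum, sum_sq_mul_invPoch hq L (a + 1)]
    have e1 := invPoch_sub_one hq (L + 1)
    have e4 : ((L + 1 : ℕ) : ℤ) - 1 = L := by push_cast; ring
    have e6 : (L : ℤ) + (a + 1 : ℕ) = (L + 1 : ℕ) + a := by push_cast; ring
    rw [e4] at e1
    rw [e6, e1]
    ring

/-! ### Bailey steps -/

/-- Reindexing of a sum against `1 / ((q)_{N-s} (q)_{s-n})` by `s = n + t`. -/
theorem sum_mul_invPoch_sub (q : ℂ) (f : ℕ → ℂ) {n N : ℕ} (h : n ≤ N) :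
    ∑ s ∈ Finset.range (N + 1), f s * invPoch q (N - s) * invPoch q (s - n)
      = ∑ t ∈ Finset.range (N - n + 1),
          f (n + t) * invPoch q ((N - n : ℕ) - t) * invPoch q t := by
  have e : N + 1 = n + (N - n + 1) := by omega
  rw [e, Finset.sum_range_add, Finset.sum_eq_zero, zero_add]
  · refine Finset.sum_congr rfl fun t _ => ?_
    have e1 : (N : ℤ) - (n + t : ℕ) = (N - n : ℕ) - t := by omega
    have e2 : ((n + t : ℕ) : ℤ) - n = t := by push_cast; ring
    rw [e1, e2]
  · intro s hs
    rw [invPoch_of_neg q (n := (s : ℤ) - n) (by have := Finset.mem_range.mp hs; omega), mul_zero]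

theorem sum_mul_invPoch_sub_of_lt (q : ℂ) (f : ℕ → ℂ) {n N : ℕ} (h : N < n) :
    ∑ s ∈ Finset.range (N + 1), f s * invPoch q (N - s) * invPoch q (s - n) = 0 := by
  refine Finset.sum_eq_zero fun s hs => ?_
  rw [invPoch_of_neg q (n := (s : ℤ) - n) (by have := Finset.mem_range.mp hs; omega), mul_zero]

/-- The Bailey kernel relative to `a = q ^ b`. -/
noncomputable def baileyKernel (q : ℂ) (b n N : ℕ) : ℂ :=
  invPoch q (N - n) * invPoch q (N + n + b)

theorem baileyKernel_of_lt (q : ℂ) (b : ℕ) {n N : ℕ} (h : N < n) : baileyKernel q b n N = 0 := by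
  rw [baileyKernel, invPoch_of_neg q (by omega), zero_mul]

/-- A Bailey step relative to `a = q ^ b`. -/
theorem sum_pow_mul_baileyKernel {q : ℂ} (hq : ‖q‖ < 1) (b n N : ℕ) :
    ∑ s ∈ Finset.range (N + 1), q ^ (s ^ 2 + b * s) * invPoch q (N - s) * baileyKernel q b n s
      = q ^ (n ^ 2 + b * n) * baileyKernel q b n N := by
  have e : ∀ s ∈ Finset.range (N + 1),
      q ^ (s ^ 2 + b * s) * invPoch q (N - s) * baileyKernel q b n s
        = (q ^ (s ^ 2 + b * s) * invPoch q (s + n + b)) * invPoch q (N - s)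
          * invPoch q (s - n) := by
    intro s _
    rw [baileyKernel]; ring
  rw [Finset.sum_congr rfl e]
  rcases lt_or_ge N n with h | h
  · rw [baileyKernel_of_lt q b h, mul_zero]
    exact sum_mul_invPoch_sub_of_lt q (fun s => q ^ (s ^ 2 + b * s) * invPoch q (s + n + b)) h
  · rw [sum_mul_invPoch_sub q (fun s => q ^ (s ^ 2 + b * s) * invPoch q (s + n + b)) h]
    -- The shift `s = n + t` turns `s² + bs` into `n² + bn` plus `t² + (2n + b) t`.
    have H := sum_sq_mul_invPoch hq (N - n) (2 * n + b)
    have e1 : ((N - n : ℕ) : ℤ) = N - n := by omega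
    have e2 : ((N - n : ℕ) : ℤ) + (2 * n + b : ℕ) = N + n + b := by push_cast; omega
    rw [e2, e1] at H
    rw [baileyKernel, ← H, Finset.mul_sum]
    refine Finset.sum_congr rfl fun t _ => ?_
    have e3 : ((n + t : ℕ) : ℤ) + n + b = t + (2 * n + b : ℕ) := by push_cast; ring
    have e4 : (n + t) ^ 2 + b * (n + t) = (n ^ 2 + b * n) + (t ^ 2 + (2 * n + b) * t) := by ring
    rw [e3, e4, e1, pow_add]
    ring

/-- A Bailey step relative to `a = 1` with the weight `q ^ (s ^ 2 - s)`. -/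
theorem sum_pow_sub_mul_baileyKernel {q : ℂ} (hq : ‖q‖ < 1) (n N : ℕ) :
    ∑ s ∈ Finset.range (N + 1), q ^ (s ^ 2 - s) * invPoch q (N - s) * baileyKernel q 0 n s
      = (q ^ (n ^ 2 + n) + q ^ (n ^ 2 - n) - q ^ (n ^ 2 + N)) * baileyKernel q 0 n N := by
  have hle (t : ℕ) : t ≤ t ^ 2 := Nat.le_self_pow (n := 2) (by simp) t
  have e : ∀ s ∈ Finset.range (N + 1),
      q ^ (s ^ 2 - s) * invPoch q (N - s) * baileyKernel q 0 n s
        = (q ^ (s ^ 2 - s) * invPoch q (s + n)) * invPoch q (N - s) * invPoch q (s - n) := by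
    intro s _
    rw [baileyKernel, Nat.cast_zero, add_zero]; ring
  rw [Finset.sum_congr rfl e]
  rcases lt_or_ge N n with h | h
  · rw [baileyKernel_of_lt q 0 h, mul_zero]
    exact sum_mul_invPoch_sub_of_lt q (fun s => q ^ (s ^ 2 - s) * invPoch q (s + n)) h
  · rw [sum_mul_invPoch_sub q (fun s => q ^ (s ^ 2 - s) * invPoch q (s + n)) h]
    have H := sum_sq_sub_mul_invPoch hq (N - n) (2 * n)
    have e1 : ((N - n : ℕ) : ℤ) = N - n := by omega
    have e2 : ((N - n : ℕ) : ℤ) + (2 * n : ℕ) = N + n := by push_cast; omega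
    have e5 : q ^ (n ^ 2 + n) = q ^ (n ^ 2 - n) * q ^ (2 * n) := by
      rw [← pow_add]; congr 1; have := hle n; omega
    have e6 : q ^ (n ^ 2 + N) = q ^ (n ^ 2 - n) * q ^ (N - n + 2 * n) := by
      rw [← pow_add]; congr 1; have := hle n; omega
    rw [e2, e1] at H
    rw [baileyKernel, Nat.cast_zero, add_zero, e5, e6]
    trans q ^ (n ^ 2 - n) * ((1 + q ^ (2 * n) - q ^ (N - n + 2 * n)) *
      (invPoch q (N - n) * invPoch q (N + n)))
    · rw [← H, Finset.mul_sum]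
      refine Finset.sum_congr rfl fun t _ => ?_
      have e3 : ((n + t : ℕ) : ℤ) + n = t + (2 * n : ℕ) := by push_cast; ring
      have e4 : (n + t) ^ 2 - (n + t) = (n ^ 2 - n) + (t ^ 2 + 2 * n * t - t) := by
        have h1 : (n + t) ^ 2 = n ^ 2 + (t ^ 2 + 2 * n * t) := by ring
        have h2 := hle n
        have h3 : t ≤ t ^ 2 + 2 * n * t := (hle t).trans (Nat.le_add_right _ _)
        omega
      rw [e3, e4, e1, pow_add]
      ring
    · ring

/-! ### The unit Bailey pair -/

/-- The unit Bailey pair relative to `a = q`, in partially summed form. -/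
theorem sum_unit_baileyKernel_partial {q : ℂ} (hq : ‖q‖ < 1) (s m : ℕ) :
    (1 - q ^ s) * ∑ n ∈ Finset.range (m + 1),
        (-1) ^ n * q ^ (n * (n - 1) / 2) * (1 - q ^ (2 * n + 1)) * baileyKernel q 1 n s
      = (-1) ^ m * q ^ (m * (m + 1) / 2) * (1 - q ^ (m + 1))
        * (invPoch q (s - m - 1) * invPoch q (s + m + 1)) := by
  -- The factor `1 - q^s` gives the partial sums a closed form, so that they telescope.
  induction m with
  | zero =>
    have h := invPoch_sub_one hq s
    simp [baileyKernel, h]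
    ring
  | succ m ih =>
    rw [Finset.sum_range_succ, mul_add, ih, baileyKernel]
    have e0 : (m + 1) * (m + 1 - 1) / 2 = m * (m + 1) / 2 := by
      rw [Nat.add_sub_cancel, mul_comm]
    have e1 : (m + 1) * (m + 1 + 1) / 2 = m * (m + 1) / 2 + (m + 1) := by
      have : (m + 1) * (m + 1 + 1) = m * (m + 1) + 2 * (m + 1) := by ring
      omega
    have e2 : (s : ℤ) - (m + 1 : ℕ) = s - m - 1 := by push_cast; ring
    have e3 : (s : ℤ) + (m + 1 : ℕ) + (1 : ℕ) = (s + m + 2 : ℕ) := by push_cast; ring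
    have e4 : (s : ℤ) + (m + 1 : ℕ) + 1 = (s + m + 2 : ℕ) := by push_cast; ring
    have h2 := invPoch_sub_one hq (s + m + 2)
    have e5 : ((s + m + 2 : ℕ) : ℤ) - 1 = s + m + 1 := by push_cast; ring
    rw [e0, e1, e2, e3, e4, ← e5, h2]
    rcases le_or_gt (m + 1) s with h | h
    · obtain ⟨d, rfl⟩ := Nat.exists_eq_add_of_le h
      have h1 := invPoch_sub_one hq d
      have e6 : ((m + 1 + d : ℕ) : ℤ) - m - 1 = d := by push_cast; ring
      rw [e6, h1]
      ring
    · rw [invPoch_of_neg q (n := (s : ℤ) - m - 1) (by omega),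
        invPoch_of_neg q (n := (s : ℤ) - m - 1 - 1) (by omega)]
      ring

/-- The unit Bailey pair relative to `a = q`. -/
theorem sum_unit_baileyKernel {q : ℂ} (hq : ‖q‖ < 1) {s L : ℕ} (h : s ≤ L) :
    ∑ n ∈ Finset.range (L + 1),
        (-1) ^ n * q ^ (n * (n - 1) / 2) * (1 - q ^ (2 * n + 1)) * baileyKernel q 1 n s
      = if s = 0 then 1 else 0 := by
  split_ifs with hs
  · subst hs
    rw [Finset.sum_range_succ', Finset.sum_eq_zero]
    · have h1 := invPoch_sub_one hq 1
      rw [Nat.cast_one, sub_self, invPoch_zero, pow_one] at h1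
      simp only [baileyKernel]
      norm_num
      exact h1.symm
    · intro n _
      rw [baileyKernel_of_lt q 1 n.succ_pos, mul_zero]
  · have H := sum_unit_baileyKernel_partial hq s L
    -- The boundary term vanishes because `s ≤ L`.
    rw [invPoch_of_neg q (n := (s : ℤ) - L - 1) (by omega), zero_mul, mul_zero] at H
    exact (mul_eq_zero.mp H).resolve_left (one_sub_pow_ne_zero hq hs)

/-! ### Limits and bounds for `q`-factorials -/

open Filter Topology in
theorem tendsto_qPoch (a : ℂ) {q : ℂ} (hq : ‖q‖ < 1) :
    Tendsto (qPoch a q) atTop (𝓝 (qPochInf a q)) :=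
  (multipliable_qPochInf a hq).hasProd.tendsto_prod_nat

theorem qPochInf_self_ne_zero {q : ℂ} (hq : ‖q‖ < 1) : qPochInf q q ≠ 0 := by
  have h : Summable fun i : ℕ => ‖-(q * q ^ i)‖ := by
    simp only [norm_neg, norm_mul, norm_pow]
    exact (summable_geometric_of_lt_one (norm_nonneg q) hq).mul_left _
  have := tprod_one_add_ne_zero_of_summable (f := fun i : ℕ => -(q * q ^ i)) (fun i => by
    rw [← sub_eq_add_neg, ← pow_succ']
    exact one_sub_pow_ne_zero hq i.succ_ne_zero) h
  simpa [qPochInf, sub_eq_add_neg] using this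

open Filter Topology in
theorem tendsto_invPoch {q : ℂ} (hq : ‖q‖ < 1) :
    Tendsto (invPoch q) atTop (𝓝 (qPochInf q q)⁻¹) := by
  have h1 : Tendsto (fun n : ℤ => (qPoch q q n.toNat)⁻¹) atTop (𝓝 (qPochInf q q)⁻¹) :=
    ((tendsto_qPoch q hq).inv₀ (qPochInf_self_ne_zero hq)).comp
      (tendsto_atTop_atTop.mpr fun b => ⟨b, fun a ha => by omega⟩)
  refine h1.congr' ?_
  filter_upwards [eventually_ge_atTop 0] with n hn
  simp [invPoch, hn]

-- The uniform bound supplies the majorants for dominated convergence.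
open Filter Topology in
theorem exists_norm_invPoch_le {q : ℂ} (hq : ‖q‖ < 1) :
    ∃ K : ℝ, 1 ≤ K ∧ ∀ n : ℤ, ‖invPoch q n‖ ≤ K := by
  have h1 := (tendsto_invPoch hq).comp tendsto_natCast_atTop_atTop
  obtain ⟨K, hK⟩ := h1.norm.bddAbove_range
  refine ⟨max K 1, le_max_right _ _, fun n => ?_⟩
  rcases le_or_gt 0 n with h | h
  · obtain ⟨m, rfl⟩ := Int.eq_ofNat_of_zero_le h
    exact (hK ⟨m, rfl⟩).trans (le_max_left _ _)
  · rw [invPoch_of_neg q h, norm_zero]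
    exact zero_le_one.trans (le_max_right _ _)

/-! ### The Jacobi triple product -/

/-- The term `(-1)^n Q^{n(n-1)/2} z^n` of the theta series, where `w = Q / z` is used to avoid
negative powers. -/
noncomputable def thetaTerm (Q z w : ℂ) : ℤ → ℂ
  | Int.ofNat n => (-1) ^ n * Q ^ (n * (n - 1) / 2) * z ^ n
  | Int.negSucc n => (-1) ^ (n + 1) * Q ^ (n * (n + 1) / 2) * w ^ (n + 1)

theorem thetaTerm_natCast (Q z w : ℂ) (n : ℕ) :
    thetaTerm Q z w n = (-1) ^ n * Q ^ (n * (n - 1) / 2) * z ^ n := rfl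

theorem thetaTerm_neg_add_one (Q z w : ℂ) (n : ℕ) :
    thetaTerm Q z w (-((n : ℤ) + 1)) = (-1) ^ (n + 1) * Q ^ (n * (n + 1) / 2) * w ^ (n + 1) := by
  rw [← Int.negSucc_eq]
  rfl

theorem thetaTerm_neg (Q z w : ℂ) (n : ℤ) : thetaTerm Q z w (-n) = thetaTerm Q w z n := by
  rcases n with n | n
  · cases n with
    | zero => simp [thetaTerm]
    | succ n =>
      have h : Int.ofNat (n + 1) = ((n : ℤ) + 1) := rfl
      rw [h, thetaTerm_neg_add_one, ← Nat.cast_succ, thetaTerm_natCast]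
      simp [mul_comm n]
  · have h : -Int.negSucc n = ((n + 1 : ℕ) : ℤ) := rfl
    rw [h, thetaTerm_natCast, Int.negSucc_eq, thetaTerm_neg_add_one]
    simp [mul_comm n]

theorem triangle_succ (n : ℕ) : (n + 1) * n / 2 = n * (n - 1) / 2 + n := by
  cases n with
  | zero => rfl
  | succ n =>
    have : (n + 1 + 1) * (n + 1) = (n + 1) * n + 2 * (n + 1) := by ring
    rw [Nat.add_sub_cancel]
    omega

/-- Consecutive theta terms have formal ratio `-z Q^n`; multiplying by `Q^(s-n)` clears negative
powers, so `z = 0` and `Q = 0` need no separate treatment. -/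
theorem neg_mul_thetaTerm {Q z w : ℂ} (h : z * w = Q) {n : ℤ} {s : ℕ} (hn : n ≤ s) :
    -(z * Q ^ s) * thetaTerm Q z w n = Q ^ (s - n).toNat * thetaTerm Q z w (n + 1) := by
  rcases n with n | n
  · have h1 : Int.ofNat n = (n : ℤ) := rfl
    rw [h1] at hn ⊢
    have h2 : ((s : ℤ) - n).toNat = s - n := by omega
    have h3 : s = (s - n) + n := by omega
    rw [h2, ← Nat.cast_succ, thetaTerm_natCast, thetaTerm_natCast, Nat.succ_eq_add_one,
      Nat.add_sub_cancel, triangle_succ]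
    nth_rewrite 1 [h3]
    ring
  · have h2 : ((s : ℤ) - Int.negSucc n).toNat = s + n + 1 := by omega
    have h3 : Int.negSucc n + 1 = -(n : ℤ) := by omega
    rw [h2, h3, thetaTerm_neg, thetaTerm_natCast, Int.negSucc_eq, thetaTerm_neg_add_one,
      mul_comm n, triangle_succ, pow_add Q (s + n) 1, pow_one]
    nth_rewrite 4 [← h]
    ring

/-- The `q`-binomial theorem in the form of a finite Jacobi triple product. -/
theorem hasSum_invPoch_mul_thetaTerm {Q z w : ℂ} (hQ : ‖Q‖ < 1) (h : z * w = Q) (s t : ℕ) :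
    HasSum (fun n : ℤ => invPoch Q (s - n) * invPoch Q (t + n) * thetaTerm Q z w n)
      (qPoch z Q s * qPoch w Q t * invPoch Q (s + t)) := by
  -- A `q`-Pascal recurrence: with `u = s + 1 - n` and `v = t + n`, use `1 - Q^(u+v) = (1 - Q^u) +
  -- Q^u (1 - Q^v)`. The second part is the old series shifted by one index.
  have step : ∀ {z w : ℂ} (_ : z * w = Q) {s t : ℕ},
      HasSum (fun n : ℤ => invPoch Q (s - n) * invPoch Q (t + n) * thetaTerm Q z w n)
        (qPoch z Q s * qPoch w Q t * invPoch Q (s + t)) →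
      HasSum (fun n : ℤ => invPoch Q ((s + 1 : ℕ) - n) * invPoch Q (t + n) * thetaTerm Q z w n)
        (qPoch z Q (s + 1) * qPoch w Q t * invPoch Q ((s + 1 : ℕ) + t)) := by
    intro z w h s t H
    have h0 : 1 - Q ^ (s + t + 1) ≠ 0 := one_sub_pow_ne_zero hQ (s + t).succ_ne_zero
    have H2 := H.add ((((Equiv.subRight (1 : ℤ)).hasSum_iff).mpr H).mul_left (-(z * Q ^ s)))
    have H3 := H2.mul_left (1 - Q ^ (s + t + 1))⁻¹
    convert! H3 using 1
    · funext n
      rw [eq_inv_mul_iff_mul_eq₀ h0]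
      simp only [Function.comp, Equiv.subRight_apply]
      have e1 : ((s + 1 : ℕ) : ℤ) - n = s - (n - 1) := by push_cast; ring
      have e2 : (t : ℤ) + (n - 1) = t + n - 1 := by ring
      rw [e1, e2]
      rcases lt_or_ge (s + 1 : ℤ) n with hn | hn
      · rw [invPoch_of_neg Q (n := s - (n - 1)) (by omega), invPoch_of_neg Q (n := s - n) (by omega)]
        ring
      rcases lt_or_ge (t + n : ℤ) 0 with hn' | hn'
      · rw [invPoch_of_neg Q (n := t + n) (by omega), invPoch_of_neg Q (n := t + n - 1) (by omega)]
        ring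
      obtain ⟨u, hu⟩ := Int.eq_ofNat_of_zero_le (show 0 ≤ (s : ℤ) - (n - 1) by omega)
      obtain ⟨v, hv⟩ := Int.eq_ofNat_of_zero_le hn'
      have e3 : (s : ℤ) - n = u - 1 := by omega
      have e4 : s + t + 1 = u + v := by omega
      have H5 := neg_mul_thetaTerm h (n := n - 1) (s := s) (by omega)
      rw [sub_add_cancel, hu, Int.toNat_natCast] at H5
      rw [e3, hu, hv, invPoch_sub_one hQ, invPoch_sub_one hQ, e4, pow_add]
      linear_combination (-(invPoch Q u * (1 - Q ^ v) * invPoch Q v)) * H5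
    · rw [eq_inv_mul_iff_mul_eq₀ h0]
      have e := invPoch_sub_one hQ (s + t + 1)
      have e1 : ((s + t + 1 : ℕ) : ℤ) - 1 = s + t := by push_cast; ring
      have e2 : ((s + 1 : ℕ) : ℤ) + t = (s + t + 1 : ℕ) := by push_cast; ring
      rw [e1] at e
      rw [e, e2, qPoch_succ]
      ring
  -- The reflection `n ↦ -n` exchanges `(z, s)` with `(w, t)`, so `step` also raises `t`.
  have symm : ∀ {z w : ℂ} {s t : ℕ},
      HasSum (fun n : ℤ => invPoch Q (s - n) * invPoch Q (t + n) * thetaTerm Q z w n)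
        (qPoch z Q s * qPoch w Q t * invPoch Q (s + t)) →
      HasSum (fun n : ℤ => invPoch Q (t - n) * invPoch Q (s + n) * thetaTerm Q w z n)
        (qPoch w Q t * qPoch z Q s * invPoch Q (t + s)) := by
    intro z w s t H
    have H2 := ((Equiv.neg ℤ).hasSum_iff).mpr H
    convert! H2 using 1
    · funext n
      simp only [Function.comp, Equiv.neg_apply, thetaTerm_neg, sub_neg_eq_add]
      rw [← sub_eq_add_neg]
      ring
    · rw [add_comm (t : ℤ)]
      ring
  have h0 : HasSum (fun n : ℤ => invPoch Q ((0 : ℕ) - n) * invPoch Q ((0 : ℕ) + n)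
      * thetaTerm Q z w n) (qPoch z Q 0 * qPoch w Q 0 * invPoch Q ((0 : ℕ) + (0 : ℕ))) := by
    have H := hasSum_single (f := fun n : ℤ => invPoch Q ((0 : ℕ) - n) * invPoch Q ((0 : ℕ) + n)
      * thetaTerm Q z w n) 0 (by
        intro n hn
        rcases lt_or_gt_of_ne hn with hn | hn
        · rw [invPoch_of_neg Q (n := (0 : ℕ) + n) (by simpa using hn)]
          ring
        · rw [invPoch_of_neg Q (n := (0 : ℕ) - n) (by simpa using hn)]
          ring)
    simpa [qPoch, thetaTerm] using H
  have h1 : ∀ s : ℕ, HasSum (fun n : ℤ => invPoch Q (s - n) * invPoch Q ((0 : ℕ) + n)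
      * thetaTerm Q z w n) (qPoch z Q s * qPoch w Q 0 * invPoch Q (s + (0 : ℕ))) := by
    intro s
    induction s with
    | zero => exact h0
    | succ s ih => exact step h ih
  induction t with
  | zero => exact h1 s
  | succ t ih => exact symm (step (by rw [mul_comm, h]) (symm ih))

theorem norm_thetaTerm_natCast_le {Q z : ℂ} (w : ℂ) (hQ : ‖Q‖ < 1) (hz : ‖z‖ ≤ 1) (n : ℕ) :
    ‖thetaTerm Q z w n‖ ≤ ‖Q‖ ^ (n - 1) := by
  rw [thetaTerm_natCast, norm_mul, norm_mul, norm_pow, norm_neg, norm_one, one_pow, one_mul,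
    norm_pow, norm_pow]
  have h1 : n - 1 ≤ n * (n - 1) / 2 := by
    rcases n with _ | _ | n
    · simp
    · simp
    · rw [Nat.le_div_iff_mul_le two_pos, mul_comm]
      gcongr
      omega
  calc ‖Q‖ ^ (n * (n - 1) / 2) * ‖z‖ ^ n ≤ ‖Q‖ ^ (n - 1) * 1 :=
        mul_le_mul (pow_le_pow_of_le_one (norm_nonneg _) hQ.le h1)
          (pow_le_one₀ (norm_nonneg _) hz) (by positivity) (by positivity)
    _ = _ := mul_one _

theorem summable_norm_thetaTerm {Q z w : ℂ} (hQ : ‖Q‖ < 1) (hz : ‖z‖ ≤ 1) (hw : ‖w‖ ≤ 1) :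
    Summable fun n : ℤ => ‖thetaTerm Q z w n‖ := by
  have hs : Summable fun n : ℕ => ‖Q‖ ^ (n - 1) := by
    rw [← summable_nat_add_iff 1]
    simpa using summable_geometric_of_lt_one (norm_nonneg Q) hQ
  refine Summable.of_nat_of_neg ?_ ?_
  · exact hs.of_nonneg_of_le (fun _ => norm_nonneg _) (norm_thetaTerm_natCast_le w hQ hz)
  · refine hs.of_nonneg_of_le (fun _ => norm_nonneg _) fun n => ?_
    rw [thetaTerm_neg]
    exact norm_thetaTerm_natCast_le z hQ hw n

open Filter Topology in
/-- The Jacobi triple product identity. -/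
theorem hasSum_thetaTerm {Q z w : ℂ} (hQ : ‖Q‖ < 1) (hz : ‖z‖ ≤ 1) (hw : ‖w‖ ≤ 1)
    (h : z * w = Q) :
    HasSum (thetaTerm Q z w) (qPochInf z Q * qPochInf w Q * qPochInf Q Q) := by
  have hsum := summable_norm_thetaTerm hQ hz hw
  obtain ⟨K, hK1, hK⟩ := exists_norm_invPoch_le hQ
  have hP := qPochInf_self_ne_zero hQ
  have l1 : Tendsto (fun N : ℕ => ∑' n : ℤ, invPoch Q (N - n) * invPoch Q (N + n)
      * thetaTerm Q z w n) atTop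
      (𝓝 (∑' n : ℤ, (qPochInf Q Q)⁻¹ * (qPochInf Q Q)⁻¹ * thetaTerm Q z w n)) := by
    refine tendsto_tsum_of_dominated_convergence (hsum.mul_left (K * K)) (fun n => ?_) ?_
    · refine Tendsto.mul_const _ (Tendsto.mul ?_ ?_)
      · exact (tendsto_invPoch hQ).comp
          (tendsto_atTop_add_const_right _ (-n) tendsto_natCast_atTop_atTop)
      · exact (tendsto_invPoch hQ).comp
          (tendsto_atTop_add_const_right _ n tendsto_natCast_atTop_atTop)
    · refine Eventually.of_forall fun N n => ?_
      rw [norm_mul, norm_mul]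
      gcongr
      · exact hK _
      · exact hK _
  have l2 : Tendsto (fun N : ℕ => qPoch z Q N * qPoch w Q N * invPoch Q (N + N)) atTop
      (𝓝 (qPochInf z Q * qPochInf w Q * (qPochInf Q Q)⁻¹)) := by
    refine ((tendsto_qPoch z hQ).mul (tendsto_qPoch w hQ)).mul ((tendsto_invPoch hQ).comp ?_)
    exact tendsto_natCast_atTop_atTop.atTop_add_atTop tendsto_natCast_atTop_atTop
  have e : ∀ N : ℕ, ∑' n : ℤ, invPoch Q (N - n) * invPoch Q (N + n) * thetaTerm Q z w n
      = qPoch z Q N * qPoch w Q N * invPoch Q (N + N) :=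
    fun N => (hasSum_invPoch_mul_thetaTerm hQ h N N).tsum_eq
  simp only [e] at l1
  have key := tendsto_nhds_unique l1 l2
  rw [tsum_mul_left] at key
  have hval : ∑' n : ℤ, thetaTerm Q z w n = qPochInf z Q * qPochInf w Q * qPochInf Q Q := by
    field_simp at key
    linear_combination key
  rw [← hval]
  exact hsum.of_norm.hasSum

/-! ### Nested sums along the Bailey chain -/

/-- The nested sum over `N ≥ s_1 ≥ ⋯ ≥ s_k ≥ 0` with weights `w i s_{i+1}` and denominators
`(q)_{N-s_1} (q)_{s_1-s_2} ⋯ (q)_{s_k}`. -/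
noncomputable def nestedSum (q : ℂ) : ℕ → (ℕ → ℕ → ℂ) → ℕ → ℂ
  | 0, _, N => invPoch q N
  | k + 1, w, N => ∑ s ∈ Finset.range (N + 1),
      w 0 s * invPoch q (N - s) * nestedSum q k (fun i => w (i + 1)) s

/-- The exponent contributed by the entry `s_{i+1} = s`. -/
def entryExponent (j k r i s : ℕ) : ℕ :=
  s ^ 2 + (if k ≤ i + r then s else 0) - if i < j then s else 0

/-- The weight contributed by the entry `s_{i+1} = s`. -/
noncomputable def entryWeight (q : ℂ) (j k r i s : ℕ) : ℂ :=
  q ^ entryExponent j k r i s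

/-- Removing the outermost entry preserves the form of the weights. The three versions serve the
first `j`, the middle and the last `r` entries respectively. -/
theorem entryWeight_succ (q : ℂ) (j k r : ℕ) :
    (fun i => entryWeight q (j + 1) (k + 1) r (i + 1)) = entryWeight q j k r := by
  funext i s
  have h : k + 1 ≤ i + 1 + r ↔ k ≤ i + r := by omega
  simp [entryWeight, entryExponent, h]

theorem entryWeight_zero_succ (q : ℂ) (k r : ℕ) :
    (fun i => entryWeight q 0 (k + 1) r (i + 1)) = entryWeight q 0 k r := by
  funext i s
  have h : k + 1 ≤ i + 1 + r ↔ k ≤ i + r := by omega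
  simp [entryWeight, entryExponent, h]

theorem entryWeight_zero_diag_succ (q : ℂ) (r : ℕ) :
    (fun i => entryWeight q 0 (r + 1) (r + 1) (i + 1)) = entryWeight q 0 r r := by
  funext i s
  have h : r + 1 ≤ i + 1 + (r + 1) := by omega
  simp [entryWeight, entryExponent, h]

/-- The coefficient of the Bailey pair obtained from the unit pair by `R` steps relative
to `a = q`. -/
noncomputable def baileyCoeff (q : ℂ) (R n : ℕ) : ℂ :=
  (-1) ^ n * q ^ (n * (n - 1) / 2 + R * (n ^ 2 + n))

theorem baileyCoeff_succ (q : ℂ) (R n : ℕ) :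
    baileyCoeff q (R + 1) n = baileyCoeff q R n * q ^ (n ^ 2 + 1 * n) := by
  rw [baileyCoeff, baileyCoeff, mul_assoc, ← pow_add]
  ring_nf

/-- The final factor `1 / (q)_{s_k}` is itself a step applied to the delta sequence, so `r` entries
amount to `r + 1` steps. A cutoff `L` independent of the inner variable allows the two sums to be
interchanged. -/
theorem nestedSum_diag {q : ℂ} (hq : ‖q‖ < 1) (r : ℕ) {N L : ℕ} (h : N ≤ L) :
    nestedSum q r (entryWeight q 0 r r) N
      = ∑ n ∈ Finset.range (L + 1),
          baileyCoeff q (r + 1) n * (1 - q ^ (2 * n + 1)) * baileyKernel q 1 n N := by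
  have step : ∀ (N R : ℕ) (f : ℕ → ℂ),
      (∀ s ≤ N, f s = ∑ n ∈ Finset.range (L + 1),
        baileyCoeff q R n * (1 - q ^ (2 * n + 1)) * baileyKernel q 1 n s) →
      ∑ s ∈ Finset.range (N + 1), q ^ (s ^ 2 + 1 * s) * invPoch q (N - s) * f s
        = ∑ n ∈ Finset.range (L + 1),
            baileyCoeff q (R + 1) n * (1 - q ^ (2 * n + 1)) * baileyKernel q 1 n N := by
    intro N R f hf
    have e : ∀ s ∈ Finset.range (N + 1), q ^ (s ^ 2 + 1 * s) * invPoch q (N - s) * f s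
        = ∑ n ∈ Finset.range (L + 1), baileyCoeff q R n * (1 - q ^ (2 * n + 1))
          * (q ^ (s ^ 2 + 1 * s) * invPoch q (N - s) * baileyKernel q 1 n s) := by
      intro s hs
      rw [hf s (by simpa [Nat.lt_succ_iff] using hs), Finset.mul_sum]
      exact Finset.sum_congr rfl fun n _ => by ring
    rw [Finset.sum_congr rfl e, Finset.sum_comm]
    refine Finset.sum_congr rfl fun n _ => ?_
    rw [← Finset.mul_sum, sum_pow_mul_baileyKernel hq, baileyCoeff_succ]
    ring
  induction r generalizing N with
  | zero =>
    rw [← step N 0 (fun s => if s = 0 then 1 else 0)]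
    · rw [Finset.sum_range_succ', Finset.sum_eq_zero]
      · simp [nestedSum]
      · intro s _
        simp
    · intro s hs
      rw [← sum_unit_baileyKernel hq (hs.trans h)]
      simp [baileyCoeff]
  | succ r ih =>
    rw [← step N (r + 1) _ fun s hs => ih (hs.trans h), nestedSum, entryWeight_zero_diag_succ]
    simp [entryWeight, entryExponent]

/-- Change of parameter from `a = q` to `a = 1`, from `1 - q^(2n+1) = (1 - q^(N+n+1)) - q^(2n+1) (1
- q^(N-n))` when `n ≤ N`. -/
theorem one_sub_pow_mul_baileyKernel {q : ℂ} (hq : ‖q‖ < 1) (n N : ℕ) :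
    (1 - q ^ (2 * n + 1)) * baileyKernel q 1 n N
      = baileyKernel q 0 n N - q ^ (2 * n + 1) * baileyKernel q 0 (n + 1) N := by
  simp only [baileyKernel]
  have e1 := invPoch_sub_one hq (N + n + 1)
  have e2 : ((N + n + 1 : ℕ) : ℤ) - 1 = N + n + (0 : ℕ) := by push_cast; ring
  have e3 : (N : ℤ) + (n + 1 : ℕ) + (0 : ℕ) = (N + n + 1 : ℕ) := by push_cast; ring
  have e4 : (N : ℤ) + n + (1 : ℕ) = (N + n + 1 : ℕ) := by push_cast; ring
  have e5 : (N : ℤ) - (n + 1 : ℕ) = N - n - 1 := by push_cast; ring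
  rw [e2] at e1
  rw [e3, e4, e5, e1]
  rcases le_or_gt n N with h | h
  · obtain ⟨d, rfl⟩ := Nat.exists_eq_add_of_le h
    have e6 : ((n + d : ℕ) : ℤ) - n = d := by push_cast; ring
    rw [e6, invPoch_sub_one hq]
    ring
  · rw [invPoch_of_neg q (n := (N : ℤ) - n) (by omega),
      invPoch_of_neg q (n := (N : ℤ) - n - 1) (by omega)]
    ring

theorem nestedSum_zero {q : ℂ} (hq : ‖q‖ < 1) (m r : ℕ) {N L : ℕ} (h : N ≤ L) :
    nestedSum q (m + r) (entryWeight q 0 (m + r) r) N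
      = ∑ n ∈ Finset.range (L + 1), baileyCoeff q (r + 1) n *
          (q ^ (m * n ^ 2) * baileyKernel q 0 n N
            - q ^ (2 * n + 1 + m * (n + 1) ^ 2) * baileyKernel q 0 (n + 1) N) := by
  induction m generalizing N with
  | zero =>
    rw [zero_add, nestedSum_diag hq r h]
    refine Finset.sum_congr rfl fun n _ => ?_
    rw [mul_assoc, one_sub_pow_mul_baileyKernel hq]
    simp
  | succ m ih =>
    rw [Nat.add_right_comm, nestedSum, entryWeight_zero_succ]
    have e : ∀ s ∈ Finset.range (N + 1), entryWeight q 0 (m + r + 1) r 0 s * invPoch q (N - s)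
          * nestedSum q (m + r) (entryWeight q 0 (m + r) r) s
        = ∑ n ∈ Finset.range (L + 1), (baileyCoeff q (r + 1) n * q ^ (m * n ^ 2)
            * (q ^ (s ^ 2 + 0 * s) * invPoch q (N - s) * baileyKernel q 0 n s)
          - baileyCoeff q (r + 1) n * q ^ (2 * n + 1 + m * (n + 1) ^ 2)
            * (q ^ (s ^ 2 + 0 * s) * invPoch q (N - s) * baileyKernel q 0 (n + 1) s)) := by
      intro s hs
      have hw : entryWeight q 0 (m + r + 1) r 0 s = q ^ (s ^ 2 + 0 * s) := by
        simp [entryWeight, entryExponent]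
      rw [hw, ih (by have := Finset.mem_range.mp hs; omega), Finset.mul_sum]
      exact Finset.sum_congr rfl fun n _ => by ring
    rw [Finset.sum_congr rfl e, Finset.sum_comm]
    refine Finset.sum_congr rfl fun n _ => ?_
    rw [Finset.sum_sub_distrib, ← Finset.mul_sum, ← Finset.mul_sum, sum_pow_mul_baileyKernel hq,
      sum_pow_mul_baileyKernel hq]
    ring

/-! ### Non-diagonal steps and Chebyshev polynomials -/

/-- The polynomials `q ^ ((j - 1) n ^ 2) U_{j-1}`, with `U` the Chebyshev polynomials of the
second kind in `q ^ n + q ^ (-n)`. -/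
noncomputable def chebyshevSum (q : ℂ) (n j : ℕ) : ℂ :=
  ∑ i ∈ Finset.range j, (q ^ (n ^ 2 + n)) ^ i * (q ^ (n ^ 2 - n)) ^ (j - 1 - i)

theorem chebyshevSum_add_two (q : ℂ) (n j : ℕ) :
    chebyshevSum q n (j + 2) = (q ^ (n ^ 2 + n) + q ^ (n ^ 2 - n)) * chebyshevSum q n (j + 1)
      - q ^ (2 * n ^ 2) * chebyshevSum q n j := by
  have h : q ^ (2 * n ^ 2) = q ^ (n ^ 2 + n) * q ^ (n ^ 2 - n) := by
    have := Nat.le_self_pow (n := 2) (by simp) n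
    rw [← pow_add]; congr 1; omega
  have e1 := geom_sum₂_succ_eq (q ^ (n ^ 2 + n)) (q ^ (n ^ 2 - n)) (n := j + 1)
  have e2 := geom_sum₂_succ_eq (q ^ (n ^ 2 + n)) (q ^ (n ^ 2 - n)) (n := j)
  simp only [chebyshevSum, Nat.add_sub_cancel, h] at e1 e2 ⊢
  rw [show j + 2 - 1 = j + 1 from rfl, e1]
  linear_combination (-q ^ (n ^ 2 + n)) * e2

/-- The correction's factor `q^s` turns the weight `q^(s²-s)` into `q^(s²)`, for which the step is
diagonal. The two contributions recombine by the Chebyshev recurrence, so the shape persists with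
`j` raised by one. -/
theorem sum_pow_sub_mul_chebyshevSum {q : ℂ} (hq : ‖q‖ < 1) (j n N : ℕ) :
    ∑ s ∈ Finset.range (N + 1), q ^ (s ^ 2 - s) * invPoch q (N - s)
        * ((chebyshevSum q n (j + 1) - q ^ (n ^ 2 + s) * chebyshevSum q n j)
          * baileyKernel q 0 n s)
      = (chebyshevSum q n (j + 2) - q ^ (n ^ 2 + N) * chebyshevSum q n (j + 1))
          * baileyKernel q 0 n N := by
  have e : ∀ s ∈ Finset.range (N + 1), q ^ (s ^ 2 - s) * invPoch q (N - s)
        * ((chebyshevSum q n (j + 1) - q ^ (n ^ 2 + s) * chebyshevSum q n j)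
          * baileyKernel q 0 n s)
      = chebyshevSum q n (j + 1) * (q ^ (s ^ 2 - s) * invPoch q (N - s) * baileyKernel q 0 n s)
        - q ^ (n ^ 2) * chebyshevSum q n j
          * (q ^ (s ^ 2 + 0 * s) * invPoch q (N - s) * baileyKernel q 0 n s) := by
    intro s _
    have h : q ^ (s ^ 2 + 0 * s) = q ^ (s ^ 2 - s) * q ^ s := by
      have := Nat.le_self_pow (n := 2) (by simp) s
      rw [← pow_add]; congr 1; omega
    rw [h]
    ring
  rw [Finset.sum_congr rfl e, Finset.sum_sub_distrib, ← Finset.mul_sum, ← Finset.mul_sum,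
    sum_pow_mul_baileyKernel hq, sum_pow_sub_mul_baileyKernel hq, chebyshevSum_add_two]
  ring

theorem nestedSum_eq {q : ℂ} (hq : ‖q‖ < 1) (j m r : ℕ) {N L : ℕ} (h : N ≤ L) :
    nestedSum q (j + (m + r)) (entryWeight q j (j + (m + r)) r) N
      = ∑ n ∈ Finset.range (L + 1), baileyCoeff q (r + 1) n *
          (q ^ (m * n ^ 2) * ((chebyshevSum q n (j + 1) - q ^ (n ^ 2 + N) * chebyshevSum q n j)
              * baileyKernel q 0 n N)
            - q ^ (2 * n + 1 + m * (n + 1) ^ 2)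
              * ((chebyshevSum q (n + 1) (j + 1) - q ^ ((n + 1) ^ 2 + N) * chebyshevSum q (n + 1) j)
                * baileyKernel q 0 (n + 1) N)) := by
  induction j generalizing N with
  | zero =>
    rw [zero_add, nestedSum_zero hq m r h]
    simp [chebyshevSum]
  | succ j ih =>
    rw [Nat.add_right_comm, nestedSum, entryWeight_succ]
    have e : ∀ s ∈ Finset.range (N + 1),
        entryWeight q (j + 1) (j + (m + r) + 1) r 0 s * invPoch q (N - s)
          * nestedSum q (j + (m + r)) (entryWeight q j (j + (m + r)) r) s
        = ∑ n ∈ Finset.range (L + 1), (baileyCoeff q (r + 1) n * q ^ (m * n ^ 2)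
            * (q ^ (s ^ 2 - s) * invPoch q (N - s)
              * ((chebyshevSum q n (j + 1) - q ^ (n ^ 2 + s) * chebyshevSum q n j)
                * baileyKernel q 0 n s))
          - baileyCoeff q (r + 1) n * q ^ (2 * n + 1 + m * (n + 1) ^ 2)
            * (q ^ (s ^ 2 - s) * invPoch q (N - s)
              * ((chebyshevSum q (n + 1) (j + 1) - q ^ ((n + 1) ^ 2 + s) * chebyshevSum q (n + 1) j)
                * baileyKernel q 0 (n + 1) s))) := by
      intro s hs
      have hw : entryWeight q (j + 1) (j + (m + r) + 1) r 0 s = q ^ (s ^ 2 - s) := by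
        -- The first `j` and the last `r` entries do not overlap; this is where `j + r ≤ k` matters.
        have : ¬ (j + (m + r) + 1 ≤ 0 + r) := by omega
        simp only [entryWeight, entryExponent, this, if_false, add_zero, Nat.succ_pos, if_true]
      rw [hw, ih (by have := Finset.mem_range.mp hs; omega), Finset.mul_sum]
      exact Finset.sum_congr rfl fun n _ => by ring
    rw [Finset.sum_congr rfl e, Finset.sum_comm]
    refine Finset.sum_congr rfl fun n _ => ?_
    rw [Finset.sum_sub_distrib, ← Finset.mul_sum, ← Finset.mul_sum,
      sum_pow_sub_mul_chebyshevSum hq, sum_pow_sub_mul_chebyshevSum hq]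
    ring

/-! ### The multisum as a limit of nested sums -/

/-- The summand with weights `w`, for arbitrary `s`; it vanishes unless `s` is antitone. -/
noncomputable def weightedTerm (q : ℂ) (k : ℕ) (w : ℕ → ℕ → ℂ) (s : Fin k → ℕ) : ℂ :=
  ∏ i ∈ Finset.range k, w i (entry s i) * invPoch q (entry s i - entry s (i + 1))

theorem entry_cons_zero {k : ℕ} (x : ℕ) (t : Fin k → ℕ) :
    entry (Fin.cons x t : Fin (k + 1) → ℕ) 0 = x := by
  simp [entry]

theorem entry_cons_succ {k : ℕ} (x : ℕ) (t : Fin k → ℕ) (i : ℕ) :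
    entry (Fin.cons x t : Fin (k + 1) → ℕ) (i + 1) = entry t i := by
  by_cases h : i < k
  · have h' : i + 1 < k + 1 := by omega
    have : (⟨i + 1, h'⟩ : Fin (k + 1)) = Fin.succ ⟨i, h⟩ := rfl
    simp only [entry, h, h', dif_pos]
    rw [this, Fin.cons_succ]
  · simp [entry, h]

theorem weightedTerm_cons (q : ℂ) (k : ℕ) (w : ℕ → ℕ → ℂ) (x : ℕ) (t : Fin k → ℕ) :
    weightedTerm q (k + 1) w (Fin.cons x t)
      = w 0 x * (invPoch q (x - entry t 0) * weightedTerm q k (fun i => w (i + 1)) t) := by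
  rw [weightedTerm, Finset.prod_range_succ', weightedTerm]
  simp only [entry_cons_succ, entry_cons_zero, zero_add]
  ring

theorem summable_prod_pi {g : ℕ → ℝ} (hg : ∀ n, 0 ≤ g n) (hs : Summable g) (k : ℕ) :
    Summable fun s : Fin k → ℕ => ∏ i, g (s i) := by
  classical
  refine summable_of_sum_le (c := (∑' n, g n) ^ k) (fun s => Finset.prod_nonneg fun i _ => hg _) ?_
  intro u
  let B : Finset ℕ := u.biUnion fun s => Finset.univ.image s
  have hsub : u ⊆ Fintype.piFinset fun _ : Fin k => B := by
    intro s hs'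
    rw [Fintype.mem_piFinset]
    intro i
    exact Finset.mem_biUnion.mpr ⟨s, hs', Finset.mem_image_of_mem _ (Finset.mem_univ i)⟩
  calc ∑ s ∈ u, ∏ i, g (s i)
      ≤ ∑ s ∈ Fintype.piFinset fun _ : Fin k => B, ∏ i, g (s i) :=
        Finset.sum_le_sum_of_subset_of_nonneg hsub
          fun s _ _ => Finset.prod_nonneg fun i _ => hg _
    _ = ∏ _i : Fin k, ∑ n ∈ B, g n := (Finset.prod_univ_sum (fun _ => B) fun _ n => g n).symm
    _ = (∑ n ∈ B, g n) ^ k := by simp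
    _ ≤ _ := pow_le_pow_left₀ (Finset.sum_nonneg fun n _ => hg n)
        (hs.sum_le_tsum B fun n _ => hg n) k

theorem entry_fin {k : ℕ} (s : Fin k → ℕ) (i : Fin k) : entry s i = s i := by
  simp [entry]

theorem summable_norm_weightedTerm {q : ℂ} (hq : ‖q‖ < 1) (k : ℕ) {w : ℕ → ℕ → ℂ} {g : ℕ → ℝ}
    (hs : Summable g) (hw : ∀ i n, ‖w i n‖ ≤ g n) :
    Summable fun s : Fin k → ℕ => ‖weightedTerm q k w s‖ := by
  obtain ⟨K, hK1, hK⟩ := exists_norm_invPoch_le hq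
  have hK0 : 0 ≤ K := zero_le_one.trans hK1
  have hg : ∀ n, 0 ≤ g n := fun n => (norm_nonneg _).trans (hw 0 n)
  refine (summable_prod_pi (fun n => mul_nonneg (hg n) hK0) (hs.mul_right K) k).of_nonneg_of_le
    (fun _ => norm_nonneg _) fun s => ?_
  rw [weightedTerm, norm_prod, Finset.prod_range]
  refine Finset.prod_le_prod (fun _ _ => norm_nonneg _) fun i _ => ?_
  rw [norm_mul, entry_fin]
  exact mul_le_mul (hw _ _) (hK _) (norm_nonneg _) (hg _)

/-- Fibring over `s_1` reproduces the recursion of `nestedSum`; its outer sum is finite because `1 /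
(q)_{N-x}` vanishes for `x > N`. -/
theorem hasSum_weightedTerm {q : ℂ} (hq : ‖q‖ < 1) {g : ℕ → ℝ} (hs : Summable g) (k : ℕ)
    {w : ℕ → ℕ → ℂ} (hw : ∀ i n, ‖w i n‖ ≤ g n) (N : ℕ) :
    HasSum (fun s : Fin k → ℕ => invPoch q (N - entry s 0) * weightedTerm q k w s)
      (nestedSum q k w N) := by
  induction k generalizing w N with
  | zero =>
    convert! hasSum_unique (fun s : Fin 0 → ℕ => invPoch q (N - entry s 0) * weightedTerm q 0 w s)
      using 1
    simp [nestedSum, weightedTerm, entry]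
  | succ k ih =>
    obtain ⟨K, hK1, hK⟩ := exists_norm_invPoch_le hq
    have hsum : Summable fun s : Fin (k + 1) → ℕ =>
        invPoch q (N - entry s 0) * weightedTerm q (k + 1) w s := by
      refine Summable.of_norm_bounded
        ((summable_norm_weightedTerm hq (k + 1) hs hw).mul_left K) fun s => ?_
      rw [norm_mul]
      exact mul_le_mul_of_nonneg_right (hK _) (norm_nonneg _)
    have h1 := hsum.hasSum
    rw [← (Fin.consEquiv fun _ : Fin (k + 1) => ℕ).hasSum_iff] at h1
    have h2 := h1.prod_fiberwise (g := fun x => w 0 x * invPoch q (N - x)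
        * nestedSum q k (fun i => w (i + 1)) x) fun x => by
      have h3 := (ih (w := fun i => w (i + 1)) (fun i n => hw (i + 1) n) x).mul_left
        (w 0 x * invPoch q (N - x))
      convert! h3 using 1
      funext t
      simp only [Function.comp, Fin.consEquiv, Equiv.coe_fn_mk]
      rw [weightedTerm_cons, entry_cons_zero]
      ring
    have h4 : HasSum (fun x => w 0 x * invPoch q (N - x)
        * nestedSum q k (fun i => w (i + 1)) x) (nestedSum q (k + 1) w N) := by
      refine hasSum_sum_of_ne_finset_zero fun x hx => ?_
      rw [invPoch_of_neg q (n := (N : ℤ) - x) (by simp at hx; omega)]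
      ring
    rw [← h2.unique h4]
    exact hsum.hasSum

-- Only the factor `1 / (q)_{N-s_1}` depends on `N`, and it tends to `1 / (q)_∞`.
open Filter Topology in
theorem tendsto_nestedSum {q : ℂ} (hq : ‖q‖ < 1) {g : ℕ → ℝ} (hs : Summable g) (k : ℕ)
    {w : ℕ → ℕ → ℂ} (hw : ∀ i n, ‖w i n‖ ≤ g n) :
    Tendsto (nestedSum q k w) atTop
      (𝓝 ((qPochInf q q)⁻¹ * ∑' s : Fin k → ℕ, weightedTerm q k w s)) := by
  obtain ⟨K, hK1, hK⟩ := exists_norm_invPoch_le hq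
  rw [← tsum_mul_left]
  have e : nestedSum q k w = fun N : ℕ => ∑' s : Fin k → ℕ,
      invPoch q (N - entry s 0) * weightedTerm q k w s :=
    funext fun N => (hasSum_weightedTerm hq hs k hw N).tsum_eq.symm
  rw [e]
  refine tendsto_tsum_of_dominated_convergence
    ((summable_norm_weightedTerm hq k hs hw).mul_left K) (fun s => ?_) ?_
  · refine Tendsto.mul_const _ ((tendsto_invPoch hq).comp ?_)
    exact tendsto_atTop_add_const_right _ (-(entry s 0 : ℤ)) tendsto_natCast_atTop_atTop
  · refine Eventually.of_forall fun N s => ?_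
    rw [norm_mul]
    exact mul_le_mul_of_nonneg_right (hK _) (norm_nonneg _)

/-! ### Weights, exponents and the antitone support -/

theorem summable_pow_sq_sub {x : ℝ} (h0 : 0 ≤ x) (h1 : x < 1) :
    Summable fun n : ℕ => x ^ (n ^ 2 - n) := by
  rw [← summable_nat_add_iff 1]
  refine (summable_geometric_of_lt_one h0 h1).of_nonneg_of_le (fun n => by positivity) fun n => ?_
  refine pow_le_pow_of_le_one h0 h1.le ?_
  have : (n + 1) ^ 2 = n + (n + 1) + n ^ 2 := by ring
  omega

theorem norm_entryWeight_le {q : ℂ} (hq : ‖q‖ < 1) (j k r i n : ℕ) :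
    ‖entryWeight q j k r i n‖ ≤ ‖q‖ ^ (n ^ 2 - n) := by
  rw [entryWeight, norm_pow]
  refine pow_le_pow_of_le_one (norm_nonneg _) hq.le ?_
  rw [entryExponent]
  split_ifs <;> omega

/-- The truncated subtraction is exact since `s ≤ s²`. -/
theorem natCast_entryExponent (j k r i s : ℕ) :
    (entryExponent j k r i s : ℤ)
      = (s : ℤ) ^ 2 + (if k ≤ i + r then (s : ℤ) else 0) - if i < j then (s : ℤ) else 0 := by
  have h : s ≤ s ^ 2 := Nat.le_self_pow (n := 2) (by simp) s
  rw [entryExponent, Nat.cast_sub]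
  · push_cast
    rfl
  · split_ifs <;> omega

theorem multisumExponent_eq {k j r : ℕ} (hj : j ≤ k) (s : Fin k → ℕ) :
    multisumExponent k j r s
      = ((∑ i ∈ Finset.range k, entryExponent j k r i (entry s i) : ℕ) : ℤ) := by
  have e1 : (Finset.range k).filter (fun i => k ≤ i + r) = Finset.Ico (k - r) k := by
    ext i
    simp only [Finset.mem_filter, Finset.mem_range, Finset.mem_Ico]
    omega
  have e2 : (Finset.range k).filter (fun i => i < j) = Finset.range j := by
    ext i
    simp only [Finset.mem_filter, Finset.mem_range]
    omega
  push_cast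
  simp only [natCast_entryExponent, Finset.sum_sub_distrib, Finset.sum_add_distrib,
    ← Finset.sum_filter, e1, e2, multisumExponent]
  ring

theorem entry_succ_le {k : ℕ} {s : Fin k → ℕ} (hs : Antitone s) (i : ℕ) :
    entry s (i + 1) ≤ entry s i := by
  by_cases h : i + 1 < k
  · have h' : i < k := by omega
    simp only [entry, h, h', dif_pos]
    exact hs (by simp)
  · simp [entry, h]

theorem antitone_of_entry_succ_le {k : ℕ} {s : Fin k → ℕ}
    (h : ∀ i < k, entry s (i + 1) ≤ entry s i) : Antitone s := by
  have h' : Antitone (entry s) := by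
    refine antitone_nat_of_succ_le fun i => ?_
    by_cases hi : i < k
    · exact h i hi
    · simp [entry, show ¬ i + 1 < k by omega]
  intro a b hab
  rw [← entry_fin s a, ← entry_fin s b]
  exact h' hab

theorem weightedTerm_eq_zero (q : ℂ) {k : ℕ} (w : ℕ → ℕ → ℂ) {s : Fin k → ℕ} (hs : ¬ Antitone s) :
    weightedTerm q k w s = 0 := by
  have : ∃ i < k, entry s i < entry s (i + 1) := by
    by_contra! h
    exact hs (antitone_of_entry_succ_le h)
  obtain ⟨i, hi, h⟩ := this
  refine Finset.prod_eq_zero (Finset.mem_range.mpr hi) ?_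
  rw [invPoch_of_neg q (by omega), mul_zero]

theorem weightedTerm_entryWeight (q : ℂ) {k j r : ℕ} (hj : j ≤ k) {s : Fin k → ℕ}
    (hs : Antitone s) :
    weightedTerm q k (entryWeight q j k r) s
      = q ^ multisumExponent k j r s / multisumDenominator k q s := by
  rw [multisumExponent_eq hj, zpow_natCast, weightedTerm, multisumDenominator,
    Finset.prod_mul_distrib, div_eq_mul_inv, ← Finset.prod_inv_distrib]
  simp only [entryWeight, Finset.prod_pow_eq_pow_sum]
  congr 1
  refine Finset.prod_congr rfl fun i _ => ?_
  rw [← Nat.cast_sub (entry_succ_le hs i), invPoch_natCast]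

/-! ### The limit of the Bailey side -/

theorem norm_baileyCoeff_le {q : ℂ} (hq : ‖q‖ < 1) (R n : ℕ) :
    ‖baileyCoeff q (R + 1) n‖ ≤ ‖q‖ ^ n := by
  rw [baileyCoeff, norm_mul, norm_pow, norm_neg, norm_one, one_pow, one_mul, norm_pow]
  refine pow_le_pow_of_le_one (norm_nonneg _) hq.le ?_
  nlinarith [Nat.zero_le (n * (n - 1) / 2), Nat.zero_le (R * (n ^ 2 + n)), Nat.zero_le (n ^ 2)]

theorem norm_pow_le_one {q : ℂ} (hq : ‖q‖ < 1) (n : ℕ) : ‖q ^ n‖ ≤ 1 := by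
  rw [norm_pow]
  exact pow_le_one₀ (norm_nonneg _) hq.le

theorem norm_chebyshevSum_le {q : ℂ} (hq : ‖q‖ < 1) (n j : ℕ) : ‖chebyshevSum q n j‖ ≤ j := by
  refine (norm_sum_le _ _).trans ?_
  calc _ ≤ ∑ _i ∈ Finset.range j, (1 : ℝ) := Finset.sum_le_sum fun i _ => by
        rw [← pow_mul, ← pow_mul, ← pow_add]
        exact norm_pow_le_one hq _
    _ = j := by simp

/-- The terms of the theta series which is the limit of the nested sums. -/
noncomputable def limitTerm (q : ℂ) (j m r n : ℕ) : ℂ :=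
  baileyCoeff q (r + 1) n * (q ^ (m * n ^ 2) * chebyshevSum q n (j + 1)
    - q ^ (2 * n + 1 + m * (n + 1) ^ 2) * chebyshevSum q (n + 1) (j + 1))

open Filter Topology in
theorem tendsto_nestedSum_limitTerm {q : ℂ} (hq : ‖q‖ < 1) (j m r : ℕ) :
    Tendsto (nestedSum q (j + (m + r)) (entryWeight q j (j + (m + r)) r)) atTop
      (𝓝 (∑' n, limitTerm q j m r n * ((qPochInf q q)⁻¹ * (qPochInf q q)⁻¹))) := by
  obtain ⟨K, hK1, hK⟩ := exists_norm_invPoch_le hq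
  let W : ℕ → ℕ → ℂ := fun n N => (chebyshevSum q n (j + 1) - q ^ (n ^ 2 + N) * chebyshevSum q n j)
    * baileyKernel q 0 n N
  -- The kernel vanishes for `n > N`, so the finite sum extends to all `n`, giving an index set
  -- independent of `N`.
  have e : nestedSum q (j + (m + r)) (entryWeight q j (j + (m + r)) r) = fun N =>
      ∑' n, baileyCoeff q (r + 1) n *
        (q ^ (m * n ^ 2) * W n N - q ^ (2 * n + 1 + m * (n + 1) ^ 2) * W (n + 1) N) := by
    funext N
    rw [nestedSum_eq hq j m r le_rfl, tsum_eq_sum]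
    intro n hn
    have hn' : N < n := by simpa [Nat.lt_succ_iff] using hn
    simp only [W]
    rw [baileyKernel_of_lt q 0 hn', baileyKernel_of_lt q 0 (Nat.lt_succ_of_lt hn')]
    ring
  have hW : ∀ n N, ‖W n N‖ ≤ (2 * j + 1) * (K * K) := by
    intro n N
    simp only [W, baileyKernel]
    rw [norm_mul, norm_mul (invPoch q _)]
    refine mul_le_mul ?_ (mul_le_mul (hK _) (hK _) (norm_nonneg _) (by linarith)) (by positivity)
      (by positivity)
    refine (norm_sub_le _ _).trans ?_
    rw [norm_mul]
    have h1 := norm_chebyshevSum_le hq n (j + 1)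
    have h2 := norm_chebyshevSum_le hq n j
    have h3 := mul_le_mul (norm_pow_le_one hq (n ^ 2 + N)) h2 (norm_nonneg _) zero_le_one
    push_cast at h1
    linarith
  have hWlim : ∀ n, Tendsto (W n) atTop
      (𝓝 (chebyshevSum q n (j + 1) * ((qPochInf q q)⁻¹ * (qPochInf q q)⁻¹))) := by
    intro n
    refine Tendsto.mul ?_ (Tendsto.mul ?_ ?_)
    · have h1 : Tendsto (fun N : ℕ => q ^ (n ^ 2 + N)) atTop (𝓝 0) :=
        (tendsto_pow_atTop_nhds_zero_of_norm_lt_one hq).comp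
          (tendsto_atTop_mono (fun N => Nat.le_add_left N _) tendsto_id)
      simpa using (h1.mul_const (chebyshevSum q n j)).const_sub (chebyshevSum q n (j + 1))
    · exact (tendsto_invPoch hq).comp
        (tendsto_atTop_add_const_right _ (-(n : ℤ)) tendsto_natCast_atTop_atTop)
    · exact (tendsto_invPoch hq).comp (tendsto_atTop_add_const_right _ _
        (tendsto_atTop_add_const_right _ (n : ℤ) tendsto_natCast_atTop_atTop))
  rw [e]
  refine tendsto_tsum_of_dominated_convergence
    ((summable_geometric_of_lt_one (norm_nonneg q) hq).mul_right (2 * ((2 * j + 1) * (K * K))))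
    (fun n => ?_) (Eventually.of_forall fun N n => ?_)
  · have := (((hWlim n).const_mul (q ^ (m * n ^ 2))).sub
      ((hWlim (n + 1)).const_mul (q ^ (2 * n + 1 + m * (n + 1) ^ 2)))).const_mul
        (baileyCoeff q (r + 1) n)
    convert! this using 2
    rw [limitTerm]
    ring
  · rw [norm_mul]
    refine mul_le_mul (norm_baileyCoeff_le hq r n) ?_ (norm_nonneg _) (by positivity)
    refine (norm_sub_le _ _).trans ?_
    rw [norm_mul _ (W n N), norm_mul _ (W (n + 1) N)]
    have h1 := mul_le_mul (norm_pow_le_one hq (m * n ^ 2)) (hW n N) (norm_nonneg _) zero_le_one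
    have h2 := mul_le_mul (norm_pow_le_one hq (2 * n + 1 + m * (n + 1) ^ 2)) (hW (n + 1) N)
      (norm_nonneg _) zero_le_one
    linarith

/-! ### Identification with theta series -/

theorem baileyCoeff_mul_eq_thetaTerm (q : ℂ) {j m r s : ℕ} (hs : s ≤ j) (n : ℕ) :
    baileyCoeff q (r + 1) n * (q ^ (m * n ^ 2)
        * ((q ^ (n ^ 2 + n)) ^ s * (q ^ (n ^ 2 - n)) ^ (j - s)))
      = thetaTerm (q ^ (2 * (j + (m + r)) + 3)) (q ^ (m + 2 * r + 2 + 2 * s))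
          (q ^ (2 * j + m + 1 - 2 * s)) n := by
  rw [thetaTerm_natCast, baileyCoeff]
  simp only [← pow_mul, mul_assoc, ← pow_add]
  congr 2
  obtain ⟨d, rfl⟩ := Nat.exists_eq_add_of_le hs
  rw [Nat.add_sub_cancel_left]
  cases n with
  | zero => simp
  | succ n =>
    have h1 : (n + 1) ^ 2 - (n + 1) = (n + 1) * n := by
      rw [Nat.sub_eq_iff_eq_add (by nlinarith)]; ring
    have h2 : (n + 1) * n = 2 * ((n + 1) * n / 2) := by
      have := (Nat.even_mul_succ_self n).two_dvd
      rw [mul_comm n] at this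
      exact (Nat.mul_div_cancel' this).symm
    rw [h1, Nat.add_sub_cancel]
    generalize (n + 1) * n / 2 = x at h2 ⊢
    zify at h2 ⊢
    linear_combination (m + r + d + s + 1 : ℤ) * h2

/-- The subtracted half of `limitTerm` provides the negative indices. The exponents `s` and `j - s`
trade places here, so that both halves belong to the same theta series. -/
theorem baileyCoeff_mul_eq_thetaTerm_neg (q : ℂ) {j m r s : ℕ} (hs : s ≤ j) (n : ℕ) :
    -(baileyCoeff q (r + 1) n * (q ^ (2 * n + 1 + m * (n + 1) ^ 2)
        * ((q ^ ((n + 1) ^ 2 - (n + 1))) ^ s * (q ^ ((n + 1) ^ 2 + (n + 1))) ^ (j - s))))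
      = thetaTerm (q ^ (2 * (j + (m + r)) + 3)) (q ^ (m + 2 * r + 2 + 2 * s))
          (q ^ (2 * j + m + 1 - 2 * s)) (-((n : ℤ) + 1)) := by
  rw [thetaTerm_neg_add_one, baileyCoeff, pow_succ (-1 : ℂ)]
  simp only [← pow_mul, mul_assoc, ← pow_add, neg_mul, one_mul, ← mul_neg]
  congr 3
  obtain ⟨d, rfl⟩ := Nat.exists_eq_add_of_le hs
  have h3 : 2 * (s + d) + m + 1 - 2 * s = 2 * d + m + 1 := by omega
  have h1 : (n + 1) ^ 2 - (n + 1) = (n + 1) * n := by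
    rw [Nat.sub_eq_iff_eq_add (by nlinarith)]; ring
  have h2 : (n + 1) * n = 2 * (n * (n - 1) / 2 + n) := by
    have := (Nat.even_mul_succ_self n).two_dvd
    rw [mul_comm n] at this
    rw [← triangle_succ]
    exact (Nat.mul_div_cancel' this).symm
  rw [Nat.add_sub_cancel_left, h1, h3, mul_comm n (n + 1), triangle_succ]
  generalize n * (n - 1) / 2 = x at h2 ⊢
  zify at h2 ⊢
  linear_combination (m + r + d + s + 1 : ℤ) * h2

theorem hasSum_limitTerm {q : ℂ} (hq : ‖q‖ < 1) (j m r : ℕ) :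
    HasSum (limitTerm q j m r) (∑ s ∈ Finset.range (j + 1),
      qPochInf (q ^ (m + 2 * r + 2 + 2 * s)) (q ^ (2 * (j + (m + r)) + 3))
        * qPochInf (q ^ (2 * j + m + 1 - 2 * s)) (q ^ (2 * (j + (m + r)) + 3))
        * qPochInf (q ^ (2 * (j + (m + r)) + 3)) (q ^ (2 * (j + (m + r)) + 3))) := by
  have hQ : ‖q ^ (2 * (j + (m + r)) + 3)‖ < 1 := by
    rw [norm_pow]
    exact pow_lt_one₀ (norm_nonneg q) hq (by simp)
  have H : ∀ s ∈ Finset.range (j + 1), _ := fun s hs =>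
    (hasSum_thetaTerm (z := q ^ (m + 2 * r + 2 + 2 * s)) (w := q ^ (2 * j + m + 1 - 2 * s)) hQ
      (norm_pow_le_one hq _) (norm_pow_le_one hq _) (by
        have := Finset.mem_range.mp hs
        rw [← pow_add]; congr 1; omega)).nat_add_neg_add_one
  convert! hasSum_sum H using 1
  funext n
  rw [Finset.sum_add_distrib]
  have e1 : ∀ s ∈ Finset.range (j + 1), _ := fun s hs =>
    (baileyCoeff_mul_eq_thetaTerm q (m := m) (r := r)
      (Nat.lt_succ_iff.mp (Finset.mem_range.mp hs)) n).symm
  have e2 : ∀ s ∈ Finset.range (j + 1), _ := fun s hs =>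
    (baileyCoeff_mul_eq_thetaTerm_neg q (m := m) (r := r)
      (Nat.lt_succ_iff.mp (Finset.mem_range.mp hs)) n).symm
  -- `geom_sum₂_comm` undoes the exchange of `s` and `j - s` in the negative half.
  rw [Finset.sum_congr rfl e1, Finset.sum_congr rfl e2, Finset.sum_neg_distrib, ← Finset.mul_sum,
    ← Finset.mul_sum, ← Finset.mul_sum, ← Finset.mul_sum, limitTerm, chebyshevSum, chebyshevSum,
    geom_sum₂_comm (q ^ ((n + 1) ^ 2 + (n + 1)))]
  simp only [Nat.add_sub_cancel]
  ring

/-! ### Conclusion -/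

theorem theorem3p2 (k j r : ℕ) (hjr : j + r ≤ k) (q : ℂ) (hq : ‖q‖ < 1) :
    HasSum
      (fun s : {s : Fin k → ℕ // Antitone s} =>
        q ^ multisumExponent k j r s.1 / multisumDenominator k q s.1)
      (∑ s ∈ Finset.range (j + 1), productTerm k j r s q) := by
  have hg := summable_pow_sq_sub (norm_nonneg q) hq
  have hw := norm_entryWeight_le hq j k r
  have hP := qPochInf_self_ne_zero hq
  have hsum : HasSum (weightedTerm q k (entryWeight q j k r))
      (∑' s, weightedTerm q k (entryWeight q j k r) s) :=
    (summable_norm_weightedTerm hq k hg hw).of_norm.hasSum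
  have hval : ∑' s, weightedTerm q k (entryWeight q j k r) s
      = ∑ s ∈ Finset.range (j + 1), productTerm k j r s q := by
    have l1 := tendsto_nestedSum hq hg k hw
    obtain ⟨m, rfl⟩ : ∃ m, k = j + (m + r) := ⟨k - j - r, by omega⟩
    -- Comparing the two limits leaves one factor `1 / (q)_∞` after cancellation.
    have key := tendsto_nhds_unique l1 (tendsto_nestedSum_limitTerm hq j m r)
    rw [tsum_mul_right, (hasSum_limitTerm hq j m r).tsum_eq] at key
    have e : ∑ s ∈ Finset.range (j + 1), productTerm (j + (m + r)) j r s q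
        = (∑ s ∈ Finset.range (j + 1),
            qPochInf (q ^ (m + 2 * r + 2 + 2 * s)) (q ^ (2 * (j + (m + r)) + 3))
              * qPochInf (q ^ (2 * j + m + 1 - 2 * s)) (q ^ (2 * (j + (m + r)) + 3))
              * qPochInf (q ^ (2 * (j + (m + r)) + 3)) (q ^ (2 * (j + (m + r)) + 3)))
          * (qPochInf q q)⁻¹ := by
      rw [Finset.sum_mul]
      refine Finset.sum_congr rfl fun s hs => ?_
      have hs' := Finset.mem_range.mp hs
      have e1 : ((j + (m + r) : ℕ) : ℤ) + 1 - r + j - 2 * s = (2 * j + m + 1 - 2 * s : ℕ) := by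
        omega
      have e2 : ((j + (m + r) : ℕ) : ℤ) + 2 + r - j + 2 * s = (m + 2 * r + 2 + 2 * s : ℕ) := by
        omega
      rw [productTerm, e1, e2, zpow_natCast, zpow_natCast]
      ring
    rw [e, eq_mul_inv_iff_mul_eq₀ hP, mul_comm]
    field_simp at key
    exact key
  rw [hval] at hsum
  have hsub := (hasSum_subtype_iff_of_support_subset (s := {s : Fin k → ℕ | Antitone s})
    (fun s hs => by
      by_contra h
      exact hs (weightedTerm_eq_zero q _ h))).mpr hsum
  convert! hsub using 1
  funext s
  exact (weightedTerm_entryWeight q (by omega) s.2).symm
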